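/- For permutations $\sigma\in S_k$, $\tau\in S_l$ let $\sigma\oplus\tau\in S_{k+l}$ (direct sum) be given by $i\mapsto\sigma(i)$ for $i\le k$ and $i\mapsto\tau(i-k)+k$ for $i>k$, and let $\sigma\ominus\tau\in S_{k+l}$ (skew sum) be given by $i\mapsto\sigma(i)+l$ for $i\le k$ and $i\mapsto\tau(i-k)$ for $i>k$. A permutation is separable if it can be obtained from the singleton permutation by iterating direct sums and skew sums. Let $\mathrm{SEP}(n)\subseteq S_n$ be the set of separable permutations, $s_n=|\mathrm{SEP}(n)|$, and let $E_n$ be the expectation for the uniform probability measure on $\mathrm{SEP}(n)$. Put $B_n(\sigma)=\min\{j\ge1:\sigma(\{1,\dots,j\})=\{1,\dots,j\}\}$; so $\sigma\in S_n$ is indecomposable (not a direct sum of two nonempty permutations) if and only if $B_n(\sigma)=n$. For signs $a,b\in\{+,-\}$, an alternating subsequence of type $(a,b)$ of $\sigma\in S_n$ is a subsequence $\sigma_{i_1},\dots,\sigma_{i_k}$, $1\le i_1<\dots<i_k\le n$, whose consecutive steps are alternately ascents and descents, whose first step is an ascent if $a=+$ and a descent if $a=-$, and whose last step is an ascent if $b=+$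 and a descent if $b=-$; by convention a singleton is of the types $(+,-)$ and $(-,+)$ but not of the types $(+,+)$ and $(-,-)$. Let $A_n^{a,b}(\sigma)$ be the length of the longest alternating subsequence of type $(a,b)$ of $\sigma$ ($0$ if there is none). Define $$C_n^{a,b}=E_n\big((A_n^{a,b})^2\mid B_n=n\big),\qquad H^{a,b}(t)=\sum_{n=1}^\infty s_nC_n^{a,b}t^n .$$ Then for every real $t$ with $|t|<3-2\sqrt2$ the series for $H^{+,-}(t)$ and $H^{-,-}(t)$ converge absolutely, and $$\begin{aligned}H^{+,-}(t)={}&2t^2(1-t)^2(t^2-6t+1)^{-\frac32}+\frac{-5t^3+8t^2-3t}{t-3}(t^2-6t+1)^{-\frac12}\\&+\frac12\,\frac{t^2(1-t)}{t-3}(t^2-6t+1)^{\frac12}-\frac12t^2(1-t),\\ H^{-,-}(t)={}&H^{+,-}(t)-\frac{-5t^3+8t^2-3t}{t-3}-\frac12\,\frac{t^2(1-t)}{t-3}(t^2-6t+1)\\&+\frac12t^2(1-t)(t^2-6t+1)^{\frac12}+\frac12t(1-t)-\frac12t(t^2-6t+1)^{\frac12}+2t^2(1-t)(t^2-6t+1)^{-\frac12}.\end{aligned}$$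 -/

import Mathlib

namespace SeparablePerm

/-- The direct sum `σ ⊕ τ`: `σ` acts on the first `k` points, and `τ`, shifted by `k`, on the
last `l` points. -/
def directSum {k l : ℕ} (σ : Equiv.Perm (Fin k)) (τ : Equiv.Perm (Fin l)) :
    Equiv.Perm (Fin (k + l)) :=
  finSumFinEquiv.symm.trans ((Equiv.sumCongr σ τ).trans finSumFinEquiv)

/-- The skew sum `σ ⊖ τ`: the first `k` points are mapped by `σ` followed by a shift by `l`,
the last `l` points are mapped by `τ` to the first `l` values. -/
def skewSum {k l : ℕ} (σ : Equiv.Perm (Fin k)) (τ : Equiv.Perm (Fin l)) :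
    Equiv.Perm (Fin (k + l)) :=
  finSumFinEquiv.symm.trans ((Equiv.sumCongr σ τ).trans
    ((Equiv.sumComm (Fin k) (Fin l)).trans
      (finSumFinEquiv.trans (finCongr (Nat.add_comm l k)))))

theorem directSum_left {k l : ℕ} (σ : Equiv.Perm (Fin k)) (τ : Equiv.Perm (Fin l)) (i : Fin k) :
    (directSum σ τ (Fin.castAdd l i) : ℕ) = σ i := by
  simp [directSum]

theorem directSum_right {k l : ℕ} (σ : Equiv.Perm (Fin k)) (τ : Equiv.Perm (Fin l)) (i : Fin l) :
    (directSum σ τ (Fin.natAdd k i) : ℕ) = τ i + k := by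
  simp [directSum, Nat.add_comm]

theorem skewSum_left {k l : ℕ} (σ : Equiv.Perm (Fin k)) (τ : Equiv.Perm (Fin l)) (i : Fin k) :
    (skewSum σ τ (Fin.castAdd l i) : ℕ) = σ i + l := by
  simp [skewSum, Nat.add_comm]

theorem skewSum_right {k l : ℕ} (σ : Equiv.Perm (Fin k)) (τ : Equiv.Perm (Fin l)) (i : Fin l) :
    (skewSum σ τ (Fin.natAdd k i) : ℕ) = τ i := by
  simp [skewSum]

/-- A permutation is separable if it can be obtained from the singleton permutation by iterating
direct sums and skew sums. -/
inductive IsSeparable : ∀ {n : ℕ}, Equiv.Perm (Fin n) → Prop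
  | singleton : IsSeparable (1 : Equiv.Perm (Fin 1))
  | directSum {k l : ℕ} {σ : Equiv.Perm (Fin k)} {τ : Equiv.Perm (Fin l)} :
      IsSeparable σ → IsSeparable τ → IsSeparable (directSum σ τ)
  | skewSum {k l : ℕ} {σ : Equiv.Perm (Fin k)} {τ : Equiv.Perm (Fin l)} :
      IsSeparable σ → IsSeparable τ → IsSeparable (skewSum σ τ)

open Classical in
/-- `SEP n`: the separable permutations of `n` points. -/
noncomputable def SEP (n : ℕ) : Finset (Equiv.Perm (Fin n)) :=
  Finset.univ.filter (fun σ => IsSeparable σ)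

/-- `s n`: the number of separable permutations of `n` points. -/
noncomputable def s (n : ℕ) : ℕ := (SEP n).card

/-- The length of the first indecomposable block of `σ`: the least `j ≥ 1` such that `σ` maps
the set of the first `j` points onto itself. Hence `σ` is indecomposable iff it equals `n`. -/
noncomputable def firstBlock {n : ℕ} (σ : Equiv.Perm (Fin n)) : ℕ :=
  sInf {j : ℕ | 1 ≤ j ∧ σ '' {i : Fin n | (i : ℕ) < j} = {i : Fin n | (i : ℕ) < j}}

/-- A sign says whether a step is an ascent (`+`) or a descent (`-`). -/
inductive Sign : Type
  | plus : Sign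
  | minus : Sign

/-- The opposite sign. -/
def Sign.opp : Sign → Sign
  | plus => minus
  | minus => plus

/-- The step from the value `x` to the value `y` is an ascent (for `+`), a descent (for `-`). -/
def IsStep {n : ℕ} : Sign → Fin n → Fin n → Prop
  | Sign.plus, x, y => x < y
  | Sign.minus, x, y => y < x

/-- The list is a nonempty alternating sequence of type `(a, b)`: its first step has sign `a`,
its steps alternate in sign, and its last step has sign `b`. By convention a singleton is of the
types `(+,-)` and `(-,+)`, and not of the types `(+,+)` and `(-,-)`; so a list `[x, y]` is of
type `(a, b)` iff the step from `x` to `y` has sign `a` and `a = b`. -/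
def IsAlternating {n : ℕ} : Sign → Sign → List (Fin n) → Prop
  | _, _, [] => False
  | a, b, [_] => a ≠ b
  | a, b, x :: y :: l => IsStep a x y ∧ IsAlternating a.opp b (y :: l)

/-- `A^{a,b}(σ)`: the length of the longest alternating subsequence of type `(a, b)` of the
one-line notation of `σ`; it is `0` if there is none. -/
noncomputable def A (a b : Sign) {n : ℕ} (σ : Equiv.Perm (Fin n)) : ℕ :=
  sSup {k : ℕ | ∃ l : List (Fin n),
    l.Sublist (List.ofFn σ) ∧ IsAlternating a b l ∧ l.length = k}

/-- Expectation with respect to the uniform probability measure on `SEP n`. -/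
noncomputable def expect (n : ℕ) (X : Equiv.Perm (Fin n) → ℝ) : ℝ :=
  (∑ σ ∈ SEP n, X σ) / (s n : ℝ)

/-- Conditional expectation given the event `E`, with respect to the uniform probability measure
on `SEP n`: the expectation of `X` times the indicator of `E`, over the probability of `E`. -/
noncomputable def condExpect (n : ℕ) (X : Equiv.Perm (Fin n) → ℝ)
    (E : Set (Equiv.Perm (Fin n))) : ℝ :=
  expect n (E.indicator X) / expect n (E.indicator 1)

/-- The conditional second moment `C_n^{a,b}` of `A^{a,b}` given that the uniformly random
separable permutation of `n` points is indecomposable. -/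
noncomputable def C (a b : Sign) (n : ℕ) : ℝ :=
  condExpect n (fun σ => (A a b σ : ℝ) ^ 2) {σ | firstBlock σ = n}

/-- The term of degree `n` of the generating function `H^{a,b}` at `t`. -/
noncomputable def HTerm (a b : Sign) (t : ℝ) (n : ℕ) : ℝ := (s n : ℝ) * C a b n * t ^ n

/-- The generating function `H^{a,b}(t) = ∑_{n ≥ 1} s_n C_n^{a,b} t^n`. -/
noncomputable def H (a b : Sign) (t : ℝ) : ℝ := ∑' n : ℕ, HTerm a b t (n + 1)

end SeparablePerm

/-!
# Longest alternating subsequences of indecomposable separable permutations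

If every connecting step between two nonempty sequences `τ` and `ρ` has the same sign `s`, then
`A^{a,b}(τ ρ) = A^{a,-s}(τ) + A^{-s,b}(ρ)` (`altLen_append`): an alternating subsequence that meets
both parts is cut into one of type `(a,-s)` and one of type `(-s,b)`, and the convention for
singletons makes this exact; dropping an end point takes care of subsequences inside one part. In
particular `A^{a,b}(τ ⊕ ρ) = A^{a,-}(τ) + A^{-,b}(ρ)`.

Let `w^{a,b}` and `g^{a,b}` be the generating functions `∑ u ^ A^{a,b}(σ) t ^ |σ|` over all and over
the indecomposable separable permutations. Splitting off the first indecomposable block gives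
`w^{a,b} = g^{a,b} + g^{a,-} w^{-,b}` (`gfAll_eq`). Complementation exchanges direct and skew sums
and reverses the signs, and a separable permutation with at least two points is a direct or a skew
sum but not both, so `g^{a,b} + g^{-a,-b} = w^{a,b} + t u ^ A^{a,b}(1)`
(`gfIndec_add_gfIndec_opp`). Eliminating `w` leaves, for `T = g^{-,-}` and `Y = g^{+,-} = g^{-,+}`,
the two equations `Y (1 - 2T) = t u (1 - T)` and `Y² = (T - t) (1 - T)`.

At `u = 1` they give `Y = T = (1 + t - q) / 4` with `q² = t² - 6t + 1`. Applying the derivation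
`u d/du` once and twice gives linear systems with determinant `q` for the first and second moments
(`first_moments`, `second_moments`). Half of the separable permutations with at least two points
are indecomposable, so the second moments are the coefficients of `H` up to a factor `2`, with a
correction at `n = 1` (`s_mul_C`). Finally, `q` and `1 / q` are products of binomial series in
`(3 + 2√2) t` and `(3 - 2√2) t`, which converge absolutely for `|t| < 3 - 2√2`, so the identities
of formal power series may be evaluated there.

Permutations are handled in one-line notation, as lists of natural numbers, in which direct sums
are associative on the nose.
-/

namespace SeparablePerm

open scoped Polynomial PowerSeries

/-! ### Alternating sequences in lists of natural numbers -/

/-- The step from `x` to `y` is an ascent (for `+`), a descent (for `-`). -/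
def NatStep : Sign → ℕ → ℕ → Prop
  | Sign.plus, x, y => x < y
  | Sign.minus, x, y => y < x

/-- The analogue of `IsAlternating` for lists of natural numbers. -/
def Alt : Sign → Sign → List ℕ → Prop
  | _, _, [] => False
  | a, b, [_] => a ≠ b
  | a, b, x :: y :: l => NatStep a x y ∧ Alt a.opp b (y :: l)

/-- The length of the longest alternating sublist of type `(a, b)`, or `0` if there is none. -/
noncomputable def altLen (a b : Sign) (l : List ℕ) : ℕ :=
  sSup {k : ℕ | ∃ m : List ℕ, m.Sublist l ∧ Alt a b m ∧ m.length = k}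

theorem Sign.opp_opp (a : Sign) : a.opp.opp = a := by cases a <;> rfl

theorem Sign.eq_or_eq_opp (a s : Sign) : a = s ∨ a = s.opp := by
  cases a <;> cases s <;> simp [Sign.opp]

theorem Sign.opp_ne (a : Sign) : a.opp ≠ a := by cases a <;> simp [Sign.opp]

theorem natStep_iff_of_natStep {s a : Sign} {x y : ℕ} (h : NatStep s x y) :
    NatStep a x y ↔ a = s := by
  cases s <;> cases a <;> simp only [NatStep] at * <;> simp <;> omega

theorem Alt.ne_nil {a b : Sign} {l : List ℕ} (h : Alt a b l) : l ≠ [] := by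
  rintro rfl
  exact h

theorem alt_map_val {n : ℕ} (a b : Sign) (l : List (Fin n)) :
    Alt a b (l.map Fin.val) ↔ IsAlternating a b l := by
  induction l generalizing a with
  | nil => simp [Alt, IsAlternating]
  | cons x l ih =>
    cases l with
    | nil => simp [Alt, IsAlternating]
    | cons y l =>
      have h : NatStep a x y ↔ IsStep a x y := by cases a <;> simp [NatStep, IsStep]
      simpa [Alt, IsAlternating, h] using fun _ => ih a.opp

theorem alt_map_of_natStep {f : ℕ → ℕ} {g : Sign → Sign} (hg : ∀ a, (g a).opp = g a.opp)
    (hinj : ∀ a b, g a ≠ g b ↔ a ≠ b) (l : List ℕ)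
    (hf : ∀ a, ∀ x ∈ l, ∀ y ∈ l, NatStep (g a) (f x) (f y) ↔ NatStep a x y) (a b : Sign) :
    Alt (g a) (g b) (l.map f) ↔ Alt a b l := by
  induction l generalizing a with
  | nil => simp [Alt]
  | cons x l ih =>
    cases l with
    | nil => simpa [Alt] using hinj a b
    | cons y l =>
      have h := ih (fun a x hx y hy => hf a x (by simp_all) y (by simp_all)) a.opp
      simp only [List.map_cons, Alt, hg] at h ⊢
      rw [h, hf a x (by simp) y (by simp)]

theorem Alt.tail {a b : Sign} {x y : ℕ} {l : List ℕ} (h : Alt a b (x :: y :: l)) :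
    Alt a.opp b (y :: l) := h.2

theorem Alt.of_concat {a b : Sign} {x : ℕ} {l : List ℕ} (hl : l ≠ []) (h : Alt a b (l ++ [x])) :
    Alt a b.opp l := by
  induction l generalizing a with
  | nil => exact absurd rfl hl
  | cons y l ih =>
    cases l with
    | nil =>
      have h2 : a.opp ≠ b := h.2
      change a ≠ b.opp
      rintro rfl
      exact h2 b.opp_opp
    | cons z l => exact ⟨h.1, ih (by simp) h.2⟩

/-- If every entry of `l₁` is joined to every entry of `l₂` by a step of sign `s`, then the type
of `l₁ ++ l₂` is determined by the types of `l₁` and `l₂`. This uses that a singleton is of the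
types `(+,-)` and `(-,+)`. -/
theorem alt_append {s : Sign} {l₁ l₂ : List ℕ} (h : ∀ x ∈ l₁, ∀ y ∈ l₂, NatStep s x y)
    (h₁ : l₁ ≠ []) (h₂ : l₂ ≠ []) (a b : Sign) :
    Alt a b (l₁ ++ l₂) ↔ Alt a s.opp l₁ ∧ Alt s.opp b l₂ := by
  induction l₁ generalizing a with
  | nil => exact absurd rfl h₁
  | cons x l ih =>
    cases l with
    | nil =>
      obtain ⟨y, l₂, rfl⟩ := List.exists_cons_of_ne_nil h₂
      have hxy := natStep_iff_of_natStep (a := a) (h x (by simp) y (by simp))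
      have ha : a ≠ s.opp ↔ a = s := by cases a <;> cases s <;> simp [Sign.opp]
      simp only [List.singleton_append, Alt, hxy, ha]
      constructor <;> rintro ⟨rfl, k⟩ <;> exact ⟨rfl, k⟩
    | cons z l =>
      have := ih (fun x hx y hy => h x (by simp_all) y hy) (by simp) a.opp
      simp only [List.cons_append, Alt] at this ⊢
      rw [this, and_assoc]

theorem bddAbove_alt_lengths (a b : Sign) (l : List ℕ) :
    BddAbove {k : ℕ | ∃ m : List ℕ, m.Sublist l ∧ Alt a b m ∧ m.length = k} :=
  ⟨l.length, by rintro _ ⟨m, hm, -, rfl⟩; exact hm.length_le⟩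

theorem length_le_altLen {a b : Sign} {l m : List ℕ} (hm : m.Sublist l) (h : Alt a b m) :
    m.length ≤ altLen a b l :=
  le_csSup (bddAbove_alt_lengths a b l) ⟨m, hm, h, rfl⟩

theorem altLen_eq_zero_or_exists (a b : Sign) (l : List ℕ) :
    altLen a b l = 0 ∨ ∃ m : List ℕ, m.Sublist l ∧ Alt a b m ∧ m.length = altLen a b l := by
  rcases Set.eq_empty_or_nonempty
    {k : ℕ | ∃ m : List ℕ, m.Sublist l ∧ Alt a b m ∧ m.length = k} with h | h
  · left
    rw [altLen, h, csSup_empty, Nat.bot_eq_zero]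
  · exact Or.inr (Nat.sSup_mem h (bddAbove_alt_lengths a b l))

theorem altLen_le {a b : Sign} {l : List ℕ} {c : ℕ}
    (h : ∀ m : List ℕ, m.Sublist l → Alt a b m → m.length ≤ c) : altLen a b l ≤ c := by
  rcases altLen_eq_zero_or_exists a b l with h0 | ⟨m, hm, hm', h1⟩
  · omega
  · exact h1 ▸ h m hm hm'

theorem altLen_mono {a b : Sign} {l l' : List ℕ} (h : l.Sublist l') :
    altLen a b l ≤ altLen a b l' :=
  altLen_le fun _ hm hm' => length_le_altLen (hm.trans h) hm'

theorem one_le_altLen {a b : Sign} (hab : a ≠ b) {l : List ℕ} (hl : l ≠ []) :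
    1 ≤ altLen a b l := by
  obtain ⟨x, l, rfl⟩ := List.exists_cons_of_ne_nil hl
  exact length_le_altLen (m := [x]) (by simp) hab

/-- Dropping the last entry of an alternating sequence changes the sign of the last step. -/
theorem altLen_le_altLen_opp_right (a b : Sign) (l : List ℕ) :
    altLen a b l ≤ altLen a b.opp l + 1 := by
  refine altLen_le fun m hm h => ?_
  rcases List.eq_nil_or_concat m with rfl | ⟨m, x, rfl⟩
  · simp
  rw [List.concat_eq_append] at *
  rcases eq_or_ne m [] with rfl | hne
  · simp
  · have := length_le_altLen ((List.sublist_append_left m [x]).trans hm) (h.of_concat hne)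
    simpa using this

/-- Dropping the first entry of an alternating sequence changes the sign of the first step. -/
theorem altLen_le_altLen_opp_left (a b : Sign) (l : List ℕ) :
    altLen a b l ≤ altLen a.opp b l + 1 := by
  refine altLen_le fun m hm h => ?_
  match m, h with
  | [x], _ => simp
  | x :: y :: m, h =>
    have := length_le_altLen ((List.sublist_cons_self x (y :: m)).trans hm) h.tail
    simpa using this

/-- The longest alternating sublists of a concatenation all of whose connecting steps have the
same sign `s`: an optimal one restricts to optimal ones of types `(a, -s)` and `(-s, b)`. -/
theorem altLen_append {s : Sign} {l₁ l₂ : List ℕ} (h : ∀ x ∈ l₁, ∀ y ∈ l₂, NatStep s x y)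
    (h₁ : l₁ ≠ []) (h₂ : l₂ ≠ []) (a b : Sign) :
    altLen a b (l₁ ++ l₂) = altLen a s.opp l₁ + altLen s.opp b l₂ := by
  have hleft : altLen a b l₁ ≤ altLen a s.opp l₁ + altLen s.opp b l₂ := by
    rcases b.eq_or_eq_opp s with rfl | rfl
    · have := one_le_altLen b.opp_ne h₂
      have := altLen_le_altLen_opp_right a b l₁
      omega
    · omega
  have hright : altLen a b l₂ ≤ altLen a s.opp l₁ + altLen s.opp b l₂ := by
    rcases a.eq_or_eq_opp s with rfl | rfl
    · have := one_le_altLen a.opp_ne.symm h₁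
      have := altLen_le_altLen_opp_left a b l₂
      omega
    · omega
  apply le_antisymm
  · refine altLen_le fun m hm hm' => ?_
    obtain ⟨m₁, m₂, rfl, hm₁, hm₂⟩ := List.sublist_append_iff.1 hm
    rcases eq_or_ne m₁ [] with rfl | hn₁
    · exact (length_le_altLen hm₂ (by simpa using hm')).trans hright
    rcases eq_or_ne m₂ [] with rfl | hn₂
    · simp only [List.append_nil] at hm' ⊢
      exact (length_le_altLen hm₁ hm').trans hleft
    · obtain ⟨k₁, k₂⟩ := (alt_append (fun x hx y hy => h x (hm₁.subset hx) y (hm₂.subset hy))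
        hn₁ hn₂ a b).1 hm'
      rw [List.length_append]
      exact add_le_add (length_le_altLen hm₁ k₁) (length_le_altLen hm₂ k₂)
  · rcases altLen_eq_zero_or_exists a s.opp l₁ with h0 | ⟨m₁, hm₁, k₁, e₁⟩
    · rcases a.eq_or_eq_opp s with rfl | rfl
      · have := one_le_altLen a.opp_ne.symm h₁
        omega
      · rw [h0, zero_add]
        exact altLen_mono (List.sublist_append_right l₁ l₂)
    rcases altLen_eq_zero_or_exists s.opp b l₂ with h0 | ⟨m₂, hm₂, k₂, e₂⟩
    · rcases b.eq_or_eq_opp s with rfl | rfl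
      · have := one_le_altLen b.opp_ne h₂
        omega
      · rw [h0, add_zero]
        exact altLen_mono (List.sublist_append_left l₁ l₂)
    rw [← e₁, ← e₂, ← List.length_append]
    exact length_le_altLen (hm₁.append hm₂) ((alt_append
      (fun x hx y hy => h x (hm₁.subset hx) y (hm₂.subset hy)) k₁.ne_nil k₂.ne_nil a b).2 ⟨k₁, k₂⟩)

/-- Relabelling the entries by a map that turns steps of sign `a` into steps of sign `g a`. -/
theorem altLen_map_of_natStep {f : ℕ → ℕ} {g : Sign → Sign} (hg : ∀ a, (g a).opp = g a.opp)
    (hinj : ∀ a b, g a ≠ g b ↔ a ≠ b) (l : List ℕ)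
    (hf : ∀ a, ∀ x ∈ l, ∀ y ∈ l, NatStep (g a) (f x) (f y) ↔ NatStep a x y) (a b : Sign) :
    altLen (g a) (g b) (l.map f) = altLen a b l := by
  have key : ∀ m : List ℕ, m.Sublist l → (Alt (g a) (g b) (m.map f) ↔ Alt a b m) := fun m hm =>
    alt_map_of_natStep hg hinj m (fun a x hx y hy => hf a x (hm.subset hx) y (hm.subset hy)) a b
  apply le_antisymm
  · refine altLen_le fun m hm h => ?_
    obtain ⟨m, hm', rfl⟩ := List.sublist_map_iff.1 hm
    rw [List.length_map]
    exact length_le_altLen hm' ((key m hm').1 h)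
  · refine altLen_le fun m hm h => ?_
    rw [← List.length_map (f := f)]
    exact length_le_altLen (hm.map f) ((key m hm).2 h)

theorem altLen_map_add (c : ℕ) (l : List ℕ) (a b : Sign) :
    altLen a b (l.map (· + c)) = altLen a b l :=
  altLen_map_of_natStep (g := id) (fun _ => rfl) (fun _ _ => Iff.rfl) l
    (fun a x _ y _ => by cases a <;> simp [NatStep]) a b

theorem altLen_singleton_of_ne {a b : Sign} (h : a ≠ b) (x : ℕ) : altLen a b [x] = 1 :=
  le_antisymm (altLen_le fun m hm _ => by simpa using hm.length_le) (one_le_altLen h (by simp))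

theorem altLen_singleton_self (a : Sign) (x : ℕ) : altLen a a [x] = 0 := by
  refine Nat.le_zero.1 (altLen_le fun m hm hm' => ?_)
  rcases List.sublist_singleton.1 hm with rfl | rfl
  · simp
  · exact absurd rfl hm'

/-! ### Separable permutations in one-line notation -/

/-- The direct sum of two permutations in one-line notation. -/
def dsum (a b : List ℕ) : List ℕ := a ++ b.map (· + a.length)

/-- The skew sum of two permutations in one-line notation. -/
def ssum (a b : List ℕ) : List ℕ := a.map (· + b.length) ++ b

/-- Separability for permutations of `{0, …, n - 1}` in one-line notation. -/
inductive IsSepList : List ℕ → Prop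
  | singleton : IsSepList [0]
  | dsum {a b : List ℕ} : IsSepList a → IsSepList b → IsSepList (dsum a b)
  | ssum {a b : List ℕ} : IsSepList a → IsSepList b → IsSepList (ssum a b)

/-- The one-line notation of a permutation of `Fin n`. -/
def oneLine {n : ℕ} (σ : Equiv.Perm (Fin n)) : List ℕ := List.ofFn fun i => (σ i : ℕ)

/-- The one-line notation of the complement `x ↦ n - 1 - σ x`. The subtraction of natural numbers is
meaningful when all entries are less than the length. -/
def compl (l : List ℕ) : List ℕ := l.map (fun x => l.length - 1 - x)

/-- No proper nonempty prefix of `l` consists of the smallest entries; for permutations, this is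
indecomposability with respect to direct sums. -/
def Indec (l : List ℕ) : Prop := ∀ j, 0 < j → j < l.length → ¬ ∀ x ∈ l.take j, x < j

theorem length_oneLine {n : ℕ} (σ : Equiv.Perm (Fin n)) : (oneLine σ).length = n := by
  simp [oneLine]

theorem oneLine_injective {n : ℕ} : Function.Injective (oneLine (n := n)) := by
  intro σ τ h
  ext i
  exact congrFun (List.ofFn_injective h) i

theorem oneLine_directSum {k l : ℕ} (σ : Equiv.Perm (Fin k)) (τ : Equiv.Perm (Fin l)) :
    oneLine (directSum σ τ) = dsum (oneLine σ) (oneLine τ) := by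
  have h : ∀ i, (directSum σ τ (Fin.castLE (Nat.le_add_right k l) i) : ℕ) = σ i :=
    directSum_left σ τ
  simp [oneLine, dsum, List.ofFn_add, h, directSum_right, List.map_ofFn, Function.comp_def]

theorem oneLine_skewSum {k l : ℕ} (σ : Equiv.Perm (Fin k)) (τ : Equiv.Perm (Fin l)) :
    oneLine (skewSum σ τ) = ssum (oneLine σ) (oneLine τ) := by
  have h : ∀ i, (skewSum σ τ (Fin.castLE (Nat.le_add_right k l) i) : ℕ) = σ i + l :=
    skewSum_left σ τ
  simp [oneLine, ssum, List.ofFn_add, h, skewSum_right, List.map_ofFn, Function.comp_def]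

theorem IsSeparable.isSepList {n : ℕ} {σ : Equiv.Perm (Fin n)} (h : IsSeparable σ) :
    IsSepList (oneLine σ) := by
  induction h with
  | singleton => exact IsSepList.singleton
  | directSum _ _ h₁ h₂ => exact oneLine_directSum _ _ ▸ h₁.dsum h₂
  | skewSum _ _ h₁ h₂ => exact oneLine_skewSum _ _ ▸ h₁.ssum h₂

theorem IsSepList.exists_oneLine {l : List ℕ} (h : IsSepList l) :
    ∃ (n : ℕ) (σ : Equiv.Perm (Fin n)), IsSeparable σ ∧ oneLine σ = l := by
  induction h with
  | singleton => exact ⟨1, 1, .singleton, rfl⟩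
  | dsum _ _ h₁ h₂ =>
    obtain ⟨_, σ, hσ, rfl⟩ := h₁
    obtain ⟨_, τ, hτ, rfl⟩ := h₂
    exact ⟨_, _, hσ.directSum hτ, oneLine_directSum σ τ⟩
  | ssum _ _ h₁ h₂ =>
    obtain ⟨_, σ, hσ, rfl⟩ := h₁
    obtain ⟨_, τ, hτ, rfl⟩ := h₂
    exact ⟨_, _, hσ.skewSum hτ, oneLine_skewSum σ τ⟩

theorem IsSepList.lt_length {l : List ℕ} (h : IsSepList l) : ∀ x ∈ l, x < l.length := by
  obtain ⟨n, σ, -, rfl⟩ := h.exists_oneLine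
  intro x hx
  obtain ⟨i, rfl⟩ := List.mem_ofFn.1 hx
  rw [length_oneLine]
  exact (σ i).2

theorem IsSepList.nodup {l : List ℕ} (h : IsSepList l) : l.Nodup := by
  obtain ⟨n, σ, -, rfl⟩ := h.exists_oneLine
  exact List.nodup_ofFn.2 (Fin.val_injective.comp σ.injective)

theorem IsSepList.ne_nil {l : List ℕ} (h : IsSepList l) : l ≠ [] := by
  induction h <;> simp_all [SeparablePerm.dsum, SeparablePerm.ssum]

theorem IsSepList.length_pos {l : List ℕ} (h : IsSepList l) : 0 < l.length :=
  List.length_pos_iff.2 h.ne_nil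

theorem length_dsum (a b : List ℕ) : (dsum a b).length = a.length + b.length := by simp [dsum]

theorem length_ssum (a b : List ℕ) : (ssum a b).length = a.length + b.length := by simp [ssum]

theorem length_compl (a : List ℕ) : (compl a).length = a.length := by simp [compl]

theorem dsum_assoc (a b c : List ℕ) : dsum (dsum a b) c = dsum a (dsum b c) := by
  simp [dsum, Function.comp_def]
  omega

/-- Pigeonhole principle: `k` distinct natural numbers are not all less than `k - 1`. -/
theorem exists_le_of_nodup {l : List ℕ} (h : l.Nodup) (hl : l ≠ []) :
    ∃ x ∈ l, l.length ≤ x + 1 := by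
  by_contra! hx
  have hsub : l.toFinset ⊆ Finset.range (l.length - 1) := by
    intro x hxl
    have := hx x (by simpa using hxl)
    simp
    omega
  have := Finset.card_le_card hsub
  rw [List.toFinset_card_of_nodup h, Finset.card_range] at this
  have := List.length_pos_iff.2 hl
  omega

theorem indec_singleton (x : ℕ) : Indec [x] := by
  intro j hj hj'
  simp at hj'
  omega

theorem not_indec_dsum {a b : List ℕ} (ha : IsSepList a) (hb : IsSepList b) :
    ¬ Indec (dsum a b) := fun h =>
  h a.length ha.length_pos (by rw [length_dsum]; have := hb.length_pos; omega)
    (by simpa [dsum] using ha.lt_length)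

/-- A skew sum is indecomposable: among the first `i` entries of its left part, the largest one is
at least `i - 1`, by the pigeonhole principle, so the shift makes a prefix too large. -/
theorem indec_ssum {a b : List ℕ} (ha : IsSepList a) (hb : IsSepList b) : Indec (ssum a b) := by
  intro j hj hj' h
  have hbp := hb.length_pos
  have hap := ha.length_pos
  rw [length_ssum] at hj'
  have hne : a.take j ≠ [] := by
    rw [← List.length_pos_iff, List.length_take]
    omega
  obtain ⟨x, hx, hx'⟩ := exists_le_of_nodup (ha.nodup.sublist (List.take_sublist j a)) hne
  have := h (x + b.length) (by
    rw [ssum, List.take_append, ← List.map_take, List.mem_append]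
    exact Or.inl (List.mem_map_of_mem hx))
  rw [List.length_take] at hx'
  omega

theorem compl_compl {l : List ℕ} (h : ∀ x ∈ l, x < l.length) : compl (compl l) = l := by
  rw [compl, length_compl, compl, List.map_map]
  conv_rhs => rw [← List.map_id l]
  refine List.map_congr_left fun x hx => ?_
  have := h x hx
  simp
  omega

theorem compl_dsum {a : List ℕ} (ha : IsSepList a) (b : List ℕ) :
    compl (dsum a b) = ssum (compl a) (compl b) := by
  rw [compl, length_dsum, ssum, dsum, List.map_append, length_compl]
  simp only [compl, List.map_map]
  congr 1 <;> refine List.map_congr_left fun x hx => ?_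
  · have := ha.lt_length x hx
    simp
    omega
  · simp
    omega

theorem compl_ssum (a : List ℕ) {b : List ℕ} (hb : IsSepList b) :
    compl (ssum a b) = dsum (compl a) (compl b) := by
  rw [compl, length_ssum, ssum, dsum, List.map_append, length_compl]
  simp only [compl, List.map_map]
  congr 1 <;> refine List.map_congr_left fun x hx => ?_
  · simp
    omega
  · have := hb.lt_length x hx
    simp
    omega

theorem IsSepList.compl {l : List ℕ} (h : IsSepList l) : IsSepList (compl l) := by
  induction h with
  | singleton => exact .singleton
  | dsum ha _ h₁ h₂ => exact compl_dsum ha _ ▸ h₁.ssum h₂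
  | ssum _ hb h₁ h₂ => exact compl_ssum _ hb ▸ h₁.dsum h₂

/-- A separable permutation with at least two points is either sum- or skew-indecomposable, but
not both. -/
theorem IsSepList.indec_compl_iff {l : List ℕ} (h : IsSepList l) (hl : l ≠ [0]) :
    Indec (SeparablePerm.compl l) ↔ ¬ Indec l := by
  cases h with
  | singleton => exact absurd rfl hl
  | dsum ha hb =>
    simpa only [compl_dsum ha _, not_indec_dsum ha hb, not_false_iff, iff_true]
      using indec_ssum ha.compl hb.compl
  | ssum ha hb =>
    simpa only [compl_ssum _ hb, indec_ssum ha hb, not_true, iff_false]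
      using not_indec_dsum ha.compl hb.compl

theorem IsSepList.indec_or_eq_dsum {l : List ℕ} (h : IsSepList l) :
    Indec l ∨ ∃ a b, IsSepList a ∧ Indec a ∧ IsSepList b ∧ l = SeparablePerm.dsum a b := by
  induction h with
  | singleton => exact Or.inl (indec_singleton 0)
  | @dsum a b ha hb h₁ h₂ =>
    right
    rcases h₁ with h₁ | ⟨a₁, a₂, h₁, hi, h₂, rfl⟩
    · exact ⟨a, b, ha, h₁, hb, rfl⟩
    · exact ⟨a₁, _, h₁, hi, h₂.dsum hb, dsum_assoc a₁ a₂ b⟩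
  | ssum ha hb => exact Or.inl (indec_ssum ha hb)

theorem length_le_of_dsum_eq {a b a' b' : List ℕ} (ha : IsSepList a) (hi' : Indec a')
    (h : dsum a b = dsum a' b') : a'.length ≤ a.length := by
  by_contra! hlt
  refine hi' a.length ha.length_pos hlt ?_
  have h1 := congrArg (List.take a.length) h
  rw [dsum, dsum, List.take_left, List.take_append_of_le_length hlt.le] at h1
  rw [← h1]
  exact ha.lt_length

/-- The first indecomposable block and the rest are determined by the permutation. -/
theorem dsum_inj {a b a' b' : List ℕ} (ha : IsSepList a) (hi : Indec a) (ha' : IsSepList a')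
    (hi' : Indec a') (h : dsum a b = dsum a' b') : a = a' ∧ b = b' := by
  have hlen := le_antisymm (length_le_of_dsum_eq ha' hi h.symm) (length_le_of_dsum_eq ha hi' h)
  obtain ⟨h1, h2⟩ := List.append_inj h hlen
  rw [hlen] at h2
  exact ⟨h1, List.map_injective_iff.2 (add_left_injective _) h2⟩

theorem altLen_dsum {a b : List ℕ} (ha : IsSepList a) (hb : IsSepList b) (c d : Sign) :
    altLen c d (dsum a b) = altLen c .minus a + altLen .minus d b := by
  rw [dsum, altLen_append (s := .plus) _ ha.ne_nil (by simpa using hb.ne_nil), altLen_map_add]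
  · rfl
  · intro x hx y hy
    obtain ⟨y, -, rfl⟩ := List.mem_map.1 hy
    have := ha.lt_length x hx
    simp only [NatStep]
    omega

theorem altLen_compl {l : List ℕ} (h : IsSepList l) (a b : Sign) :
    altLen a.opp b.opp (compl l) = altLen a b l := by
  refine altLen_map_of_natStep (fun _ => rfl)
    (fun a b => by cases a <;> cases b <;> simp [Sign.opp]) l (fun a x hx y hy => ?_) a b
  have := h.lt_length x hx
  have := h.lt_length y hy
  cases a <;> simp only [NatStep, Sign.opp] <;> omega

theorem A_eq_altLen {n : ℕ} (a b : Sign) (σ : Equiv.Perm (Fin n)) :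
    A a b σ = altLen a b (oneLine σ) := by
  have h : oneLine σ = (List.ofFn σ).map Fin.val := by
    simp [oneLine, List.map_ofFn, Function.comp_def]
  rw [A, altLen, h]
  congr 1
  ext k
  constructor
  · rintro ⟨m, hm, hm', rfl⟩
    exact ⟨m.map Fin.val, hm.map _, (alt_map_val a b m).2 hm', by simp⟩
  · rintro ⟨m, hm, hm', rfl⟩
    obtain ⟨m, hm₀, rfl⟩ := List.sublist_map_iff.1 hm
    exact ⟨m, hm₀, (alt_map_val a b m).1 hm', by simp⟩

theorem forall_mem_take_oneLine {n : ℕ} (σ : Equiv.Perm (Fin n)) (j : ℕ) :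
    (∀ x ∈ (oneLine σ).take j, x < j) ↔ ∀ i : Fin n, (i : ℕ) < j → (σ i : ℕ) < j := by
  constructor
  · intro h i hi
    refine h _ (List.mem_take_iff_getElem.2 ⟨i, by simp [oneLine, hi], by simp [oneLine]⟩)
  · intro h x hx
    obtain ⟨i, hi, rfl⟩ := List.mem_take_iff_getElem.1 hx
    simp [oneLine] at hi ⊢
    exact h ⟨i, hi.2⟩ hi.1

theorem image_eq_iff {n : ℕ} (σ : Equiv.Perm (Fin n)) (j : ℕ) :
    σ '' {i : Fin n | (i : ℕ) < j} = {i : Fin n | (i : ℕ) < j} ↔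
      ∀ i : Fin n, (i : ℕ) < j → (σ i : ℕ) < j := by
  constructor
  · intro h i hi
    have : σ i ∈ σ '' {i : Fin n | (i : ℕ) < j} := ⟨i, hi, rfl⟩
    rwa [h] at this
  · intro h
    refine Set.eq_of_subset_of_ncard_le ?_ ?_ (Set.toFinite _)
    · rintro _ ⟨i, hi, rfl⟩
      exact h i hi
    · rw [Set.ncard_image_of_injective _ σ.injective]

theorem firstBlock_eq_iff {n : ℕ} (hn : 1 ≤ n) (σ : Equiv.Perm (Fin n)) :
    firstBlock σ = n ↔ Indec (oneLine σ) := by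
  have hmem : n ∈ {j : ℕ | 1 ≤ j ∧
      σ '' {i : Fin n | (i : ℕ) < j} = {i : Fin n | (i : ℕ) < j}} :=
    ⟨hn, (image_eq_iff σ n).2 fun i _ => (σ i).2⟩
  constructor
  · intro h j hj hj' hcut
    rw [length_oneLine] at hj'
    have : firstBlock σ ≤ j :=
      Nat.sInf_le ⟨hj, (image_eq_iff σ j).2 ((forall_mem_take_oneLine σ j).1 hcut)⟩
    omega
  · intro h
    refine le_antisymm (Nat.sInf_le hmem) (le_csInf ⟨n, hmem⟩ ?_)
    rintro j ⟨hj, hj'⟩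
    by_contra! hlt
    exact h j hj (by rwa [length_oneLine])
      ((forall_mem_take_oneLine σ j).2 ((image_eq_iff σ j).1 hj'))

/-! ### Generating functions of separable permutations -/

/-- The separable permutations of `n` points in one-line notation. -/
noncomputable def sepLists (n : ℕ) : Finset (List ℕ) := (SEP n).image oneLine

open Classical in
/-- The separable permutations of `n` points that are not direct sums, in one-line notation. -/
noncomputable def indecLists (n : ℕ) : Finset (List ℕ) := (sepLists n).filter Indec

/-- The generating function `∑ u ^ A^{a,b}(σ) t ^ |σ|` over all separable permutations; `u` is the
polynomial variable and `t` the power series variable. -/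
noncomputable def gfAll (a b : Sign) : ℝ[X]⟦X⟧ :=
  PowerSeries.mk fun n => ∑ l ∈ sepLists n, Polynomial.X ^ altLen a b l

/-- The generating function `∑ u ^ A^{a,b}(σ) t ^ |σ|` over the indecomposable separable
permutations. -/
noncomputable def gfIndec (a b : Sign) : ℝ[X]⟦X⟧ :=
  PowerSeries.mk fun n => ∑ l ∈ indecLists n, Polynomial.X ^ altLen a b l

theorem mem_sepLists {n : ℕ} {l : List ℕ} : l ∈ sepLists n ↔ IsSepList l ∧ l.length = n := by
  simp only [sepLists, SEP, Finset.mem_image, Finset.mem_filter, Finset.mem_univ, true_and]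
  constructor
  · rintro ⟨σ, hσ, rfl⟩
    exact ⟨hσ.isSepList, length_oneLine σ⟩
  · rintro ⟨h, rfl⟩
    obtain ⟨n, σ, hσ, hl⟩ := h.exists_oneLine
    obtain rfl : l.length = n := hl ▸ length_oneLine σ
    exact ⟨σ, hσ, hl⟩

theorem mem_indecLists {n : ℕ} {l : List ℕ} :
    l ∈ indecLists n ↔ IsSepList l ∧ l.length = n ∧ Indec l := by
  simp only [indecLists, Finset.mem_filter, mem_sepLists, and_assoc]

/-- Splitting off the first indecomposable block of a separable permutation. -/
theorem gfAll_eq (a b : Sign) :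
    gfAll a b = gfIndec a b + gfIndec a .minus * gfAll .minus b := by
  classical
  ext1 n
  simp only [map_add, PowerSeries.coeff_mul, gfAll, gfIndec, PowerSeries.coeff_mk]
  rw [← Finset.sum_filter_add_sum_filter_not (sepLists n) Indec, indecLists]
  congr 1
  simp_rw [Finset.sum_mul_sum, ← Finset.sum_product', Finset.sum_sigma']
  symm
  refine Finset.sum_bij (fun x _ => dsum x.2.1 x.2.2) ?_ ?_ ?_ ?_
  · rintro ⟨⟨k, m⟩, l₁, l₂⟩ h
    simp only [Finset.mem_sigma, Finset.mem_product, Finset.mem_filter,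
      mem_sepLists, mem_indecLists] at h ⊢
    obtain ⟨hn, ⟨h₁, rfl, -⟩, h₂, rfl⟩ := h
    obtain rfl := Finset.HasAntidiagonal.mem_antidiagonal.1 hn
    exact ⟨⟨h₁.dsum h₂, length_dsum _ _⟩, not_indec_dsum h₁ h₂⟩
  · rintro ⟨⟨k, m⟩, l₁, l₂⟩ h ⟨⟨k', m'⟩, l₁', l₂'⟩ h' e
    simp only [Finset.mem_sigma, Finset.mem_product,
      mem_sepLists, mem_indecLists] at h h'
    obtain ⟨-, ⟨h₁, rfl, hi⟩, h₂, rfl⟩ := h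
    obtain ⟨-, ⟨h₁', rfl, hi'⟩, h₂', rfl⟩ := h'
    obtain ⟨rfl, rfl⟩ := dsum_inj h₁ hi h₁' hi' e
    rfl
  · intro l h
    obtain ⟨h, hl⟩ := Finset.mem_filter.1 h
    obtain ⟨hs, rfl⟩ := mem_sepLists.1 h
    obtain ⟨l₁, l₂, h₁, hi, h₂, rfl⟩ := hs.indec_or_eq_dsum.resolve_left hl
    refine ⟨⟨(l₁.length, l₂.length), l₁, l₂⟩, ?_, rfl⟩
    simpa [mem_sepLists, mem_indecLists, length_dsum] using ⟨⟨h₁, hi⟩, h₂⟩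
  · rintro ⟨⟨k, m⟩, l₁, l₂⟩ h
    simp only [Finset.mem_sigma, Finset.mem_product,
      mem_sepLists, mem_indecLists] at h
    rw [altLen_dsum h.2.1.1 h.2.2.1, pow_add]

/-- The complement carries the indecomposable separable permutations to the skew-indecomposable
ones; together they are all separable permutations, and only the singleton is both. -/
theorem gfIndec_add_gfIndec_opp (a b : Sign) :
    gfIndec a b + gfIndec a.opp b.opp =
      gfAll a b + PowerSeries.C (Polynomial.X ^ altLen a b [0]) * PowerSeries.X := by
  classical
  ext1 n
  have hcompl : ∑ l ∈ indecLists n, (Polynomial.X : ℝ[X]) ^ altLen a.opp b.opp l =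
      ∑ l ∈ (sepLists n).filter (fun l => Indec (compl l)), Polynomial.X ^ altLen a b l := by
    refine Finset.sum_bij' (fun l _ => compl l) (fun l _ => compl l) ?_ ?_ ?_ ?_ ?_
    · intro l h
      obtain ⟨hs, rfl, hi⟩ := mem_indecLists.1 h
      rw [Finset.mem_filter, mem_sepLists, compl_compl hs.lt_length]
      exact ⟨⟨hs.compl, length_compl l⟩, hi⟩
    · intro l h
      obtain ⟨h, hi⟩ := Finset.mem_filter.1 h
      obtain ⟨hs, rfl⟩ := mem_sepLists.1 h
      exact mem_indecLists.2 ⟨hs.compl, length_compl l, hi⟩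
    · intro l h
      exact compl_compl (mem_indecLists.1 h).1.lt_length
    · intro l h
      exact compl_compl (mem_sepLists.1 (Finset.mem_filter.1 h).1).1.lt_length
    · intro l h
      rw [← altLen_compl (mem_indecLists.1 h).1, Sign.opp_opp, Sign.opp_opp]
  have hpoint : ∀ l ∈ sepLists n,
      (if Indec l then (Polynomial.X : ℝ[X]) ^ altLen a b l else 0) +
        (if Indec (compl l) then Polynomial.X ^ altLen a b l else 0) =
      Polynomial.X ^ altLen a b l + if [0] = l then Polynomial.X ^ altLen a b l else 0 := by
    intro l h
    rcases eq_or_ne l [0] with rfl | hne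
    · have h₁ : Indec [0] := indec_singleton 0
      have h₂ : Indec (compl [0]) := indec_singleton 0
      simp [h₁, h₂]
    · have := (mem_sepLists.1 h).1.indec_compl_iff hne
      by_cases hi : Indec l <;> simp [hi, this, hne.symm]
  have hsingle : [0] ∈ sepLists n ↔ n = 1 := by
    rw [mem_sepLists]
    exact ⟨fun h => h.2.symm, fun h => ⟨.singleton, h.symm⟩⟩
  simp only [map_add, gfAll, gfIndec, PowerSeries.coeff_mk, PowerSeries.coeff_C_mul,
    PowerSeries.coeff_X]
  rw [hcompl, indecLists, Finset.sum_filter, Finset.sum_filter, ← Finset.sum_add_distrib,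
    Finset.sum_congr rfl hpoint, Finset.sum_add_distrib, Finset.sum_ite_eq]
  simp [hsingle]

/-- This also follows from reversing and complementing permutations, which exchanges the two types;
here it is a consequence of the functional equations. -/
theorem gfIndec_plus_minus_eq : gfIndec .plus .minus = gfIndec .minus .plus := by
  have h₁ := gfAll_eq .minus .minus
  have h₂ := gfAll_eq .minus .plus
  have h₃ := gfAll_eq .plus .minus
  have h₄ := gfIndec_add_gfIndec_opp .minus .plus
  have h₅ := gfIndec_add_gfIndec_opp .plus .minus
  rw [altLen_singleton_of_ne Sign.noConfusion] at h₄ h₅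
  simp only [Sign.opp] at h₄ h₅
  linear_combination (gfIndec .minus .minus - 1) * (h₅ - h₄ + h₃) - gfIndec .plus .minus * h₁ + h₂

/-- The linear equation for the generating functions of the indecomposable permutations. -/
theorem gfIndec_plus_minus_linear :
    gfIndec .plus .minus
        - (gfIndec .plus .minus * gfIndec .minus .minus
          + gfIndec .plus .minus * gfIndec .minus .minus) =
      PowerSeries.C Polynomial.X * PowerSeries.X
        - PowerSeries.C Polynomial.X * PowerSeries.X * gfIndec .minus .minus := by
  have h₂ := gfAll_eq .minus .plus
  have h₄ := gfIndec_add_gfIndec_opp .minus .plus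
  rw [altLen_singleton_of_ne Sign.noConfusion] at h₄
  simp only [Sign.opp, ← gfIndec_plus_minus_eq, pow_one] at h₂ h₄
  linear_combination (1 - gfIndec .minus .minus) * h₄ + h₂

/-- The quadratic equation for the generating functions of the indecomposable permutations. -/
theorem gfIndec_plus_minus_quadratic :
    gfIndec .plus .minus * gfIndec .plus .minus =
      (gfIndec .minus .minus - PowerSeries.X) * (1 - gfIndec .minus .minus) := by
  have h₂ := gfAll_eq .minus .plus
  have h₃ := gfAll_eq .plus .plus
  have h₄ := gfIndec_add_gfIndec_opp .plus .plus
  rw [altLen_singleton_self] at h₄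
  simp only [Sign.opp, ← gfIndec_plus_minus_eq, pow_zero, map_one, one_mul] at h₂ h₃ h₄
  linear_combination (gfIndec .minus .minus - 1) * (h₃ + h₄) - gfIndec .plus .minus * h₂

/-! ### Second moments -/

/-- The derivation `u d/du`, applied to the coefficients of a power series over `ℝ[u]`. -/
noncomputable def theta : Derivation ℝ ℝ[X]⟦X⟧ ℝ[X]⟦X⟧ :=
  Derivation.mk'
    { toFun := fun f => PowerSeries.mk fun n =>
        Polynomial.X * Polynomial.derivative (PowerSeries.coeff n f)
      map_add' := fun f g => by ext1 n; simp [mul_add]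
      map_smul' := fun c f => by ext1 n; simp }
    (fun f g => by
      ext1 n
      simp only [LinearMap.coe_mk, AddHom.coe_mk, PowerSeries.coeff_mk, smul_eq_mul, map_add,
        PowerSeries.coeff_mul, Polynomial.derivative_sum, Polynomial.derivative_mul,
        Finset.mul_sum]
      rw [← Finset.Nat.sum_antidiagonal_swap (f := fun p => PowerSeries.coeff p.1 g * _),
        ← Finset.sum_add_distrib]
      exact Finset.sum_congr rfl fun p _ => by simp only [Prod.fst_swap, Prod.snd_swap]; ring)

theorem coeff_theta (f : ℝ[X]⟦X⟧) (n : ℕ) : PowerSeries.coeff n (theta f) =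
    Polynomial.X * Polynomial.derivative (PowerSeries.coeff n f) :=
  PowerSeries.coeff_mk n fun n => Polynomial.X * Polynomial.derivative (PowerSeries.coeff n f)

theorem theta_mul (f g : ℝ[X]⟦X⟧) : theta (f * g) = theta f * g + f * theta g := by
  rw [Derivation.leibniz, smul_eq_mul, smul_eq_mul, mul_comm g, add_comm]

theorem theta_X : theta PowerSeries.X = 0 := by
  ext1 n
  rw [coeff_theta, PowerSeries.coeff_X]
  split_ifs <;> simp

theorem theta_C_X : theta (PowerSeries.C Polynomial.X) = PowerSeries.C Polynomial.X := by
  ext1 n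
  rw [coeff_theta, PowerSeries.coeff_C]
  split_ifs <;> simp

/-- Setting `u = 1` in the coefficients of a power series over `ℝ[u]`. -/
noncomputable def evalOne : ℝ[X]⟦X⟧ →+* ℝ⟦X⟧ := PowerSeries.map (Polynomial.evalRingHom 1)

theorem evalOne_X : evalOne PowerSeries.X = PowerSeries.X := PowerSeries.map_X _

theorem evalOne_C_X : evalOne (PowerSeries.C Polynomial.X) = 1 := by
  simp [evalOne, PowerSeries.map_C]

theorem coeff_evalOne_gfAll (a b : Sign) (n : ℕ) :
    PowerSeries.coeff n (evalOne (gfAll a b)) = (sepLists n).card := by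
  simp [evalOne, gfAll]

theorem coeff_evalOne_gfIndec (a b : Sign) (n : ℕ) :
    PowerSeries.coeff n (evalOne (gfIndec a b)) = (indecLists n).card := by
  simp [evalOne, gfIndec]

theorem coeff_evalOne_theta_theta_gfIndec (a b : Sign) (n : ℕ) :
    PowerSeries.coeff n (evalOne (theta (theta (gfIndec a b)))) =
      ∑ l ∈ indecLists n, (altLen a b l : ℝ) ^ 2 := by
  have h : ∀ k : ℕ, (Polynomial.X * Polynomial.derivative (Polynomial.X ^ k) : ℝ[X]) =
      (k : ℝ[X]) * Polynomial.X ^ k := by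
    rintro (_ | k)
    · simp
    · rw [Polynomial.derivative_X_pow, Nat.add_sub_cancel, pow_succ, map_natCast]
      ring
  have h' : ∀ k : ℕ, (Polynomial.X * Polynomial.derivative
      ((k : ℝ[X]) * Polynomial.X ^ k) : ℝ[X]) = (k : ℝ[X]) ^ 2 * Polynomial.X ^ k := by
    intro k
    rw [← nsmul_eq_mul, Polynomial.derivative_smul, mul_smul_comm, h, nsmul_eq_mul]
    ring
  simp only [evalOne, PowerSeries.coeff_map, coeff_theta, gfIndec, PowerSeries.coeff_mk,
    Polynomial.derivative_sum, Finset.mul_sum, h, h']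
  simp

/-! ### Solving the moment equations -/

section Moments

variable {t T T₁ T₂ Y Y₁ Y₂ q : ℝ⟦X⟧}

theorem eq_of_mul_left_of_constantCoeff_ne_zero {c f g : ℝ⟦X⟧}
    (hc : PowerSeries.constantCoeff c ≠ 0) (h : c * f = c * g) : f = g := by
  refine mul_left_cancel₀ ?_ h
  rintro rfl
  exact hc (map_zero _)

/-- Eliminating `Y` gives a cubic equation for `T`, which has the factor `1 + t - 2T`. -/
theorem quadratic_of_system (ht : PowerSeries.constantCoeff t = 0)
    (hT : PowerSeries.constantCoeff T = 0) (hlin : Y * (1 - 2 * T) = t * (1 - T))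
    (hquad : Y * Y = (T - t) * (1 - T)) : 2 * T ^ 2 = (1 + t) * T - t := by
  refine eq_of_mul_left_of_constantCoeff_ne_zero
    (c := (1 - T) * (1 + t - 2 * T)) (by simp [ht, hT]) ?_
  linear_combination (1 - 2 * T) ^ 2 * hquad - (Y * (1 - 2 * T) + t * (1 - T)) * hlin

theorem eq_of_system (hT : PowerSeries.constantCoeff T = 0)
    (hlin : Y * (1 - 2 * T) = t * (1 - T)) (h : 2 * T ^ 2 = (1 + t) * T - t) : Y = T := by
  refine eq_of_mul_left_of_constantCoeff_ne_zero (c := 1 - 2 * T) (by simp [hT]) ?_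
  linear_combination hlin + h

theorem sqrt_eq_of_quadratic (ht : PowerSeries.constantCoeff t = 0)
    (hT : PowerSeries.constantCoeff T = 0) (hq : PowerSeries.constantCoeff q = 1)
    (hqq : q ^ 2 = t ^ 2 - 6 * t + 1) (h : 2 * T ^ 2 = (1 + t) * T - t) : q = 1 + t - 4 * T := by
  refine eq_of_mul_left_of_constantCoeff_ne_zero (c := q + (1 + t - 4 * T))
    (by simp [ht, hT, hq]) ?_
  linear_combination hqq - 8 * h

/-- Cramer's rule for the first moments; the determinant of the system is `q`. -/
theorem first_moments (hq : q = 1 + t - 4 * T) (h : 2 * T ^ 2 = (1 + t) * T - t)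
    (h₁ : Y₁ * (1 - 2 * T) - 2 * T * T₁ = t * (1 - T) - t * T₁)
    (h₂ : 2 * T * Y₁ = T₁ * (1 - 2 * T + t)) :
    q * Y₁ = (1 - 2 * T + t) * (T * (1 - 2 * T)) ∧ q * T₁ = 2 * T * (T * (1 - 2 * T)) := by
  subst hq
  constructor
  · linear_combination (1 - 2 * T + t) * (h₁ + h) - (2 * T - t) * h₂
  · linear_combination 2 * T * (h₁ + h) - (1 - 2 * T) * h₂

/-- Cramer's rule for the second moments. The right-hand sides are obtained by reducing polynomials
in `t` and `T` modulo the quadratic equation for `T`. -/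
theorem second_moments (hq : q = 1 + t - 4 * T) (h : 2 * T ^ 2 = (1 + t) * T - t)
    (h₁ : q * Y₁ = (1 - 2 * T + t) * (T * (1 - 2 * T)))
    (h₂ : q * T₁ = 2 * T * (T * (1 - 2 * T)))
    (h₃ : Y₂ * (1 - 2 * T) - 4 * Y₁ * T₁ - 2 * T * T₂ = t * (1 - T) - 2 * t * T₁ - t * T₂)
    (h₄ : 2 * Y₁ ^ 2 + 2 * T * Y₂ = T₂ * (1 - 2 * T + t) - 2 * T₁ ^ 2) :
    4 * (q ^ 3 * Y₂) = 2 * t * q ^ 3 + 4 * t ^ 2 * (1 - t) ^ 2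
      + (-t ^ 4 + 4 * t ^ 3 - 5 * t ^ 2 + 2 * t) * q ^ 2 - t ^ 2 * (1 - t) * q ^ 3 ∧
    4 * (q ^ 3 * T₂) = 4 * (q ^ 3 * Y₂) - 2 * t * q ^ 3
      - (-t ^ 4 + 4 * t ^ 3 - 5 * t ^ 2 + 2 * t) * q ^ 3 + t ^ 2 * (1 - t) * q ^ 4
      + t * (1 - t) * q ^ 3 - t * q ^ 4 + 4 * t ^ 2 * (1 - t) * q ^ 2 := by
  set P := T * (1 - 2 * T) with hP
  have e₁ : q ^ 2 * ((1 - 2 * T) * Y₂ - (2 * T - t) * T₂) =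
      q ^ 2 * P + 8 * (1 - 2 * T + t) * T * P ^ 2 - 4 * t * q * T * P := by
    linear_combination q ^ 2 * (h₃ + h) + 4 * q * T₁ * h₁
      + (4 * (1 - 2 * T + t) * P - 2 * t * q) * h₂
  have e₂ : q ^ 2 * ((1 - 2 * T + t) * T₂ - 2 * T * Y₂) =
      2 * (1 - 2 * T + t) ^ 2 * P ^ 2 + 8 * T ^ 2 * P ^ 2 := by
    linear_combination 2 * (q * Y₁ + (1 - 2 * T + t) * P) * h₁
      + 2 * (q * T₁ + 2 * T * P) * h₂ - q ^ 2 * h₄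
  rw [hP] at e₁ e₂
  subst hq
  have hY : 4 * ((1 + t - 4 * T) ^ 3 * Y₂) = 2 * t * (1 + t - 4 * T) ^ 3 + 4 * t ^ 2 * (1 - t) ^ 2
      + (-t ^ 4 + 4 * t ^ 3 - 5 * t ^ 2 + 2 * t) * (1 + t - 4 * T) ^ 2
      - t ^ 2 * (1 - t) * (1 + t - 4 * T) ^ 3 := by
    linear_combination 4 * (1 - 2 * T + t) * e₁ + 4 * (2 * T - t) * e₂
      + (512 * T ^ 5 - (640 + 256 * t) * T ^ 4 + (416 + 192 * t + 32 * t ^ 2) * T ^ 3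
        - (176 + 64 * t + 48 * t ^ 2) * T ^ 2 + (40 + 24 * t + 8 * t ^ 2 + 24 * t ^ 3) * T
        - 4 - 8 * t + 8 * t ^ 2 - 8 * t ^ 3 - 4 * t ^ 4) * h
  refine ⟨hY, ?_⟩
  rw [hY]
  linear_combination 8 * T * e₁ + 4 * (1 - 2 * T) * e₂
    + (-512 * T ^ 5 + 640 * T ^ 4 + (-416 + 64 * t - 32 * t ^ 2) * T ^ 3
      + (128 + 16 * t - 32 * t ^ 2 + 112 * t ^ 3) * T ^ 2
      + (-16 - 8 * t + 8 * t ^ 2 - 40 * t ^ 3 - 40 * t ^ 4) * T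
      - 4 * t + 8 * t ^ 2 + 8 * t ^ 4 + 4 * t ^ 5) * h

end Moments

/-- The second moment series in terms of a formal square root `q` of `1 - 6t + t²`. -/
theorem moment_series_eq {q r : ℝ⟦X⟧} (hq : PowerSeries.constantCoeff q = 1)
    (hqq : q ^ 2 = PowerSeries.X ^ 2 - 6 * PowerSeries.X + 1) (hqr : q * r = 1) :
    4 * evalOne (theta (theta (gfIndec .plus .minus))) = 2 * PowerSeries.X
      + 4 * PowerSeries.X ^ 2 * (1 - PowerSeries.X) ^ 2 * r ^ 3
      + (-PowerSeries.X ^ 4 + 4 * PowerSeries.X ^ 3 - 5 * PowerSeries.X ^ 2 + 2 * PowerSeries.X) * r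
      - PowerSeries.X ^ 2 * (1 - PowerSeries.X) ∧
    4 * evalOne (theta (theta (gfIndec .minus .minus))) =
      4 * evalOne (theta (theta (gfIndec .plus .minus))) - 2 * PowerSeries.X
      - (-PowerSeries.X ^ 4 + 4 * PowerSeries.X ^ 3 - 5 * PowerSeries.X ^ 2 + 2 * PowerSeries.X)
      + PowerSeries.X ^ 2 * (1 - PowerSeries.X) * q + PowerSeries.X * (1 - PowerSeries.X)
      - PowerSeries.X * q + 4 * PowerSeries.X ^ 2 * (1 - PowerSeries.X) * r := by
  have hlin := gfIndec_plus_minus_linear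
  have hquad := gfIndec_plus_minus_quadratic
  have hlin₁ := congrArg theta hlin
  have hquad₁ := congrArg theta hquad
  simp only [map_add, map_sub, theta_mul, theta_X, theta_C_X, Derivation.map_one_eq_zero]
    at hlin₁ hquad₁
  have hlin₂ := congrArg theta hlin₁
  have hquad₂ := congrArg theta hquad₁
  simp only [map_add, map_sub, theta_mul, theta_X, theta_C_X, Derivation.map_one_eq_zero, map_zero]
    at hlin₂ hquad₂
  -- Setting `u = 1` gives equations between power series over `ℝ`.
  replace hlin := congrArg evalOne hlin
  replace hquad := congrArg evalOne hquad
  replace hlin₁ := congrArg evalOne hlin₁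
  replace hquad₁ := congrArg evalOne hquad₁
  replace hlin₂ := congrArg evalOne hlin₂
  replace hquad₂ := congrArg evalOne hquad₂
  simp only [map_add, map_sub, map_mul, map_one, map_zero, evalOne_X, evalOne_C_X]
    at hlin hquad hlin₁ hquad₁ hlin₂ hquad₂
  have hT₀ : PowerSeries.constantCoeff (evalOne (gfIndec .minus .minus)) = 0 := by
    rw [← PowerSeries.coeff_zero_eq_constantCoeff_apply, coeff_evalOne_gfIndec, Nat.cast_eq_zero,
      Finset.card_eq_zero, Finset.eq_empty_iff_forall_notMem]
    intro l hl
    obtain ⟨hl, h0, -⟩ := mem_indecLists.1 hl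
    exact hl.length_pos.ne' h0
  have hX₀ : PowerSeries.constantCoeff (PowerSeries.X : ℝ⟦X⟧) = 0 := by simp
  generalize evalOne (theta (theta (gfIndec .plus .minus))) = Y₂ at *
  generalize evalOne (theta (theta (gfIndec .minus .minus))) = T₂ at *
  generalize evalOne (theta (gfIndec .plus .minus)) = Y₁ at *
  generalize evalOne (theta (gfIndec .minus .minus)) = T₁ at *
  generalize evalOne (gfIndec .plus .minus) = Y at *
  generalize evalOne (gfIndec .minus .minus) = T at *
  generalize (PowerSeries.X : ℝ⟦X⟧) = t at *
  replace hlin : Y * (1 - 2 * T) = t * (1 - T) := by linear_combination hlin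
  have h := quadratic_of_system hX₀ hT₀ hlin hquad
  obtain rfl := eq_of_system hT₀ hlin h
  have hqT := sqrt_eq_of_quadratic hX₀ hT₀ hq hqq h
  obtain ⟨h₁, h₂⟩ := first_moments (T₁ := T₁) (Y₁ := Y₁) hqT h
    (by linear_combination hlin₁) (by linear_combination hquad₁)
  obtain ⟨hY, hT⟩ := second_moments (T₂ := T₂) (Y₂ := Y₂) hqT h h₁ h₂
    (by linear_combination hlin₂) (by linear_combination hquad₂)
  have hr : ∀ f : ℝ⟦X⟧, q ^ 3 * f * r ^ 3 = f := fun f => by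
    rw [mul_right_comm, ← mul_pow, hqr, one_pow, one_mul]
  constructor
  · rw [← hr Y₂]
    linear_combination r ^ 3 * hY + (2 * t - t ^ 2 * (1 - t)) * hr 1
      + (-t ^ 4 + 4 * t ^ 3 - 5 * t ^ 2 + 2 * t) * r * (q * r + 1) * hqr
  · rw [← hr Y₂, ← hr T₂]
    linear_combination r ^ 3 * hT
      + (-2 * t - (-t ^ 4 + 4 * t ^ 3 - 5 * t ^ 2 + 2 * t) + t * (1 - t)) * hr 1
      + (t ^ 2 * (1 - t) - t) * hr q + 4 * t ^ 2 * (1 - t) * r * (q * r + 1) * hqr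

/-! ### The conditional second moments -/

theorem card_sepLists (n : ℕ) : (sepLists n).card = s n :=
  Finset.card_image_of_injective _ oneLine_injective

/-- Sums over the indecomposable separable permutations in one-line notation. -/
theorem sum_indicator_firstBlock {n : ℕ} (hn : 1 ≤ n) (φ : List ℕ → ℝ) :
    ∑ σ ∈ SEP n, ({σ | firstBlock σ = n} : Set (Equiv.Perm (Fin n))).indicator
      (fun σ => φ (oneLine σ)) σ = ∑ l ∈ indecLists n, φ l := by
  classical
  rw [indecLists, Finset.sum_filter, sepLists, Finset.sum_image oneLine_injective.injOn]
  refine Finset.sum_congr rfl fun σ _ => ?_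
  simp only [Set.indicator_apply, Set.mem_ofPred_eq, firstBlock_eq_iff hn]

theorem two_mul_card_indecLists (n : ℕ) :
    2 * ((indecLists n).card : ℝ) = s n + if n = 1 then 1 else 0 := by
  have h := congrArg (fun f => PowerSeries.coeff n (evalOne f))
    (gfIndec_add_gfIndec_opp .plus .plus)
  simp only [map_add, coeff_evalOne_gfIndec, coeff_evalOne_gfAll, altLen_singleton_self, pow_zero,
    map_one, one_mul, evalOne_X, PowerSeries.coeff_X, card_sepLists] at h
  rw [← h, two_mul]

theorem indecLists_one : indecLists 1 = {[0]} := by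
  ext l
  rw [mem_indecLists, Finset.mem_singleton]
  constructor
  · rintro ⟨h, hl, -⟩
    obtain ⟨x, rfl⟩ := List.length_eq_one_iff.1 hl
    have := h.lt_length x (by simp)
    simp_all
  · rintro rfl
    exact ⟨.singleton, rfl, indec_singleton 0⟩

/-- For `n ≥ 2` exactly half of the separable permutations are indecomposable, so conditioning
amounts to a factor `2`. -/
theorem s_mul_C (a b : Sign) {n : ℕ} (hn : 1 ≤ n) :
    (s n : ℝ) * C a b n = 2 * ∑ l ∈ indecLists n, (altLen a b l : ℝ) ^ 2
      - if n = 1 then (altLen a b [0] : ℝ) ^ 2 else 0 := by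
  have hcard := two_mul_card_indecLists n
  have h₁ := sum_indicator_firstBlock hn (fun l => (altLen a b l : ℝ) ^ 2)
  have h₂ := sum_indicator_firstBlock hn (fun _ => (1 : ℝ))
  simp only [← A_eq_altLen] at h₁
  rw [Finset.sum_const, nsmul_eq_mul, mul_one] at h₂
  rw [C, condExpect, expect, expect, h₁,
    show (1 : Equiv.Perm (Fin n) → ℝ) = fun _ => 1 from rfl, h₂]
  split_ifs at hcard ⊢ with h
  · subst h
    have hs : (s 1 : ℝ) = 1 := by
      rw [indecLists_one, Finset.card_singleton] at hcard
      norm_num at hcard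
      linarith
    rw [hs, indecLists_one]
    simp
    ring
  · rcases eq_or_ne (s n : ℝ) 0 with h0 | h0
    · have : (indecLists n) = ∅ := by
        rw [← Finset.card_eq_zero, ← Nat.cast_eq_zero (R := ℝ)]
        linarith
      simp [h0, this]
    · have h1 : ((indecLists n).card : ℝ) = s n / 2 := by linarith
      rw [h1]
      field_simp
      ring

/-! ### Convergence -/

/-- The power series `f` converges at `t` to `v`; over the reals, convergence in the sense of
`HasSum` is absolute. -/
def EvalsTo (t : ℝ) (f : ℝ⟦X⟧) (v : ℝ) : Prop :=
  HasSum (fun n => PowerSeries.coeff n f * t ^ n) v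

section EvalsTo

variable {t v w : ℝ} {f g : ℝ⟦X⟧}

theorem EvalsTo.add (hf : EvalsTo t f v) (hg : EvalsTo t g w) : EvalsTo t (f + g) (v + w) := by
  simpa [EvalsTo, add_mul] using HasSum.add hf hg

theorem EvalsTo.sub (hf : EvalsTo t f v) (hg : EvalsTo t g w) : EvalsTo t (f - g) (v - w) := by
  simpa [EvalsTo, sub_mul] using HasSum.sub hf hg

theorem EvalsTo.mul (hf : EvalsTo t f v) (hg : EvalsTo t g w) : EvalsTo t (f * g) (v * w) := by
  have hf' := hf.summable.norm
  have hg' := hg.summable.norm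
  have h : ∀ n, ∑ p ∈ Finset.HasAntidiagonal.antidiagonal n, PowerSeries.coeff p.1 f * t ^ p.1 *
      (PowerSeries.coeff p.2 g * t ^ p.2) = PowerSeries.coeff n (f * g) * t ^ n := by
    intro n
    rw [PowerSeries.coeff_mul, Finset.sum_mul]
    refine Finset.sum_congr rfl fun p hp => ?_
    rw [← Finset.HasAntidiagonal.mem_antidiagonal.1 hp, pow_add]
    ring
  have hs := (summable_norm_sum_mul_antidiagonal_of_summable_norm hf' hg').of_norm
  have ht := tsum_mul_tsum_eq_tsum_sum_antidiagonal_of_summable_norm hf' hg'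
  simp only [h] at hs ht
  rw [hf.tsum_eq, hg.tsum_eq] at ht
  exact ht ▸ hs.hasSum

theorem evalsTo_C (c t : ℝ) : EvalsTo t (PowerSeries.C c) c := by
  have := hasSum_single (f := fun n => PowerSeries.coeff n (PowerSeries.C c) * t ^ n) 0
    (fun n hn => by simp [PowerSeries.coeff_C, hn])
  simpa [EvalsTo] using this

theorem evalsTo_one (t : ℝ) : EvalsTo t 1 1 := by
  simpa using evalsTo_C 1 t

theorem evalsTo_ofNat (n : ℕ) [n.AtLeastTwo] (t : ℝ) :
    EvalsTo t (OfNat.ofNat n : ℝ⟦X⟧) (OfNat.ofNat n) := by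
  have := evalsTo_C (OfNat.ofNat n) t
  rwa [map_ofNat] at this

theorem evalsTo_X (t : ℝ) : EvalsTo t PowerSeries.X t := by
  have := hasSum_single (f := fun n => PowerSeries.coeff n (PowerSeries.X : ℝ⟦X⟧) * t ^ n) 1
    (fun n hn => by simp [PowerSeries.coeff_X, hn])
  simpa [EvalsTo] using this

theorem EvalsTo.pow (hf : EvalsTo t f v) (n : ℕ) : EvalsTo t (f ^ n) (v ^ n) := by
  induction n with
  | zero => simpa using evalsTo_one t
  | succ n ih => simpa only [pow_succ] using ih.mul hf

theorem EvalsTo.neg (hf : EvalsTo t f v) : EvalsTo t (-f) (-v) := by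
  simpa [EvalsTo] using HasSum.neg hf

end EvalsTo

/-- The power series of `(1 - c t) ^ a`, a rescaled binomial series. -/
noncomputable def powSeries (a c : ℝ) : ℝ⟦X⟧ :=
  PowerSeries.rescale (-c) (PowerSeries.binomialSeries ℝ a)

theorem evalsTo_powSeries (a : ℝ) {c t : ℝ} (h : |c * t| < 1) :
    EvalsTo t (powSeries a c) ((1 - c * t) ^ a) := by
  have hmem : ‖-(c * t)‖ₑ < 1 := by
    rwa [enorm_neg, ← ofReal_norm, ENNReal.ofReal_lt_one]
  have hb := (Real.one_add_rpow_hasFPowerSeriesOnBall_zero (a := a)).hasSum (y := -(c * t))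
    (by simpa using hmem)
  rw [zero_add, ← sub_eq_add_neg] at hb
  refine hb.congr_fun fun n => ?_
  rw [binomialSeries_apply, powSeries, PowerSeries.coeff_rescale,
    PowerSeries.binomialSeries_coeff, List.ofFn_const, List.prod_replicate, ← neg_mul, mul_pow,
    smul_eq_mul, smul_eq_mul]
  ring

theorem powSeries_mul (a b c : ℝ) : powSeries a c * powSeries b c = powSeries (a + b) c := by
  rw [powSeries, powSeries, powSeries, PowerSeries.binomialSeries_add, map_mul]

theorem powSeries_zero (c : ℝ) : powSeries 0 c = 1 := by
  rw [powSeries, PowerSeries.binomialSeries_zero, map_one]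

theorem powSeries_one (c : ℝ) : powSeries 1 c = 1 - PowerSeries.C c * PowerSeries.X := by
  have := PowerSeries.binomialSeries_nat (R := ℝ) (A := ℝ) 1
  rw [Nat.cast_one, pow_one] at this
  rw [powSeries, this, map_add, map_one, PowerSeries.rescale_X]
  simp [sub_eq_add_neg]

theorem constantCoeff_powSeries (a c : ℝ) : PowerSeries.constantCoeff (powSeries a c) = 1 := by
  rw [powSeries, ← PowerSeries.coeff_zero_eq_constantCoeff_apply, PowerSeries.coeff_rescale]
  simp

/-- The power series of `(1 - 6t + t²) ^ a`, by the factorization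
`1 - 6t + t² = (1 - (3 + 2√2) t) (1 - (3 - 2√2) t)`. -/
noncomputable def discSeries (a : ℝ) : ℝ⟦X⟧ :=
  powSeries a (3 + 2 * √2) * powSeries a (3 - 2 * √2)

theorem disc_eq (t : ℝ) :
    t ^ 2 - 6 * t + 1 = (1 - (3 + 2 * √2) * t) * (1 - (3 - 2 * √2) * t) := by
  have h : √2 ^ 2 = 2 := Real.sq_sqrt (by norm_num)
  linear_combination 4 * t ^ 2 * h

theorem abs_mul_lt_one {t : ℝ} (ht : |t| < 3 - 2 * √2) :
    |(3 + 2 * √2) * t| < 1 ∧ |(3 - 2 * √2) * t| < 1 := by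
  have h : √2 ^ 2 = 2 := Real.sq_sqrt (by norm_num)
  have h0 : 0 ≤ √2 := Real.sqrt_nonneg 2
  have h1 : 0 < 3 - 2 * √2 := (abs_nonneg t).trans_lt ht
  have h2 : 1 < √2 := by
    rw [Real.lt_sqrt] <;> norm_num
  rw [abs_mul, abs_mul, abs_of_pos h1, abs_of_pos (by linarith : 0 < 3 + 2 * √2)]
  constructor
  · have := mul_lt_mul_of_pos_left ht (by linarith : 0 < 3 + 2 * √2)
    nlinarith
  · nlinarith [abs_nonneg t]

theorem disc_pos {t : ℝ} (ht : |t| < 3 - 2 * √2) : 0 < t ^ 2 - 6 * t + 1 := by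
  obtain ⟨h₁, h₂⟩ := abs_mul_lt_one ht
  rw [disc_eq]
  exact mul_pos (by linarith [(abs_lt.1 h₁).2]) (by linarith [(abs_lt.1 h₂).2])

theorem evalsTo_discSeries (a : ℝ) {t : ℝ} (ht : |t| < 3 - 2 * √2) :
    EvalsTo t (discSeries a) ((t ^ 2 - 6 * t + 1) ^ a) := by
  obtain ⟨h₁, h₂⟩ := abs_mul_lt_one ht
  rw [disc_eq, Real.mul_rpow (by linarith [(abs_lt.1 h₁).2]) (by linarith [(abs_lt.1 h₂).2])]
  exact (evalsTo_powSeries a h₁).mul (evalsTo_powSeries a h₂)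

theorem discSeries_mul (a b : ℝ) : discSeries a * discSeries b = discSeries (a + b) := by
  rw [discSeries, discSeries, discSeries, ← powSeries_mul, ← powSeries_mul]
  ring

theorem discSeries_zero : discSeries 0 = 1 := by
  rw [discSeries, powSeries_zero, powSeries_zero, one_mul]

theorem discSeries_one : discSeries 1 = PowerSeries.X ^ 2 - 6 * PowerSeries.X + 1 := by
  have h : √2 ^ 2 = 2 := Real.sq_sqrt (by norm_num)
  have h₁ : PowerSeries.C (3 + 2 * √2) + PowerSeries.C (3 - 2 * √2) = (6 : ℝ⟦X⟧) := by
    rw [← map_add, ← map_ofNat PowerSeries.C]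
    congr 1
    ring
  have h₂ : PowerSeries.C (3 + 2 * √2) * PowerSeries.C (3 - 2 * √2) = (1 : ℝ⟦X⟧) := by
    rw [← map_mul, ← map_one PowerSeries.C]
    congr 1
    linear_combination -4 * h
  rw [discSeries, powSeries_one, powSeries_one]
  linear_combination -PowerSeries.X * h₁ + PowerSeries.X ^ 2 * h₂

theorem constantCoeff_discSeries (a : ℝ) : PowerSeries.constantCoeff (discSeries a) = 1 := by
  rw [discSeries, map_mul, constantCoeff_powSeries, constantCoeff_powSeries, one_mul]

/-- The second moment series of the indecomposable permutations yields the series `H^{a,b}`. -/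
theorem hasSum_HTerm {a b : Sign} {t v : ℝ}
    (h : EvalsTo t (evalOne (theta (theta (gfIndec a b)))) v) :
    HasSum (fun n : ℕ => HTerm a b t (n + 1)) (2 * v - (altLen a b [0] : ℝ) ^ 2 * t) := by
  have h' := (((evalsTo_ofNat 2 t).mul h).sub ((evalsTo_C ((altLen a b [0] : ℝ) ^ 2) t).mul
    (evalsTo_X t)))
  have h0 : indecLists 0 = ∅ := by
    rw [Finset.eq_empty_iff_forall_notMem]
    intro l hl
    obtain ⟨hl, h0, -⟩ := mem_indecLists.1 hl
    exact hl.length_pos.ne' h0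
  have hcoeff : ∀ n, PowerSeries.coeff n ((2 : ℝ⟦X⟧) * evalOne (theta (theta (gfIndec a b)))
      - PowerSeries.C ((altLen a b [0] : ℝ) ^ 2) * PowerSeries.X) =
      2 * ∑ l ∈ indecLists n, (altLen a b l : ℝ) ^ 2
        - if n = 1 then (altLen a b [0] : ℝ) ^ 2 else 0 := by
    intro n
    rw [← map_ofNat PowerSeries.C, map_sub, PowerSeries.coeff_C_mul, PowerSeries.coeff_C_mul,
      PowerSeries.coeff_X, coeff_evalOne_theta_theta_gfIndec, mul_ite, mul_one, mul_zero]
  rw [EvalsTo, ← hasSum_nat_add_iff' 1, Finset.sum_range_one, hcoeff, h0] at h'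
  simp only [Finset.sum_empty, mul_zero, zero_ne_one, if_false, sub_zero, zero_mul] at h'
  refine h'.congr_fun fun n => ?_
  rw [hcoeff, ← s_mul_C a b (Nat.succ_pos n)]
  rfl

end SeparablePerm

theorem theorem4 (t : ℝ) (ht : |t| < 3 - 2 * Real.sqrt 2) :
    (Summable (fun n : ℕ => SeparablePerm.HTerm .plus .minus t (n + 1)) ∧
      SeparablePerm.H .plus .minus t =
        2 * t ^ 2 * (1 - t) ^ 2 * (t ^ 2 - 6 * t + 1) ^ (-(3 / 2) : ℝ)
        + (-5 * t ^ 3 + 8 * t ^ 2 - 3 * t) / (t - 3) * (t ^ 2 - 6 * t + 1) ^ (-(1 / 2) : ℝ)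
        + 1 / 2 * (t ^ 2 * (1 - t) / (t - 3)) * (t ^ 2 - 6 * t + 1) ^ (1 / 2 : ℝ)
        - 1 / 2 * t ^ 2 * (1 - t)) ∧
    (Summable (fun n : ℕ => SeparablePerm.HTerm .minus .minus t (n + 1)) ∧
      SeparablePerm.H .minus .minus t =
        SeparablePerm.H .plus .minus t
        - (-5 * t ^ 3 + 8 * t ^ 2 - 3 * t) / (t - 3)
        - 1 / 2 * (t ^ 2 * (1 - t) / (t - 3)) * (t ^ 2 - 6 * t + 1)
        + 1 / 2 * t ^ 2 * (1 - t) * (t ^ 2 - 6 * t + 1) ^ (1 / 2 : ℝ)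
        + 1 / 2 * t * (1 - t)
        - 1 / 2 * t * (t ^ 2 - 6 * t + 1) ^ (1 / 2 : ℝ)
        + 2 * t ^ 2 * (1 - t) * (t ^ 2 - 6 * t + 1) ^ (-(1 / 2) : ℝ)) := by
  open SeparablePerm in
  have hD := disc_pos ht
  have hq := evalsTo_discSeries (1 / 2) ht
  have hr := evalsTo_discSeries (-(1 / 2)) ht
  obtain ⟨hY, hT⟩ := moment_series_eq (constantCoeff_discSeries (1 / 2))
    (by rw [sq, discSeries_mul, ← discSeries_one]; norm_num)
    (show discSeries (1 / 2) * discSeries (-(1 / 2)) = 1 by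
      rw [discSeries_mul, ← discSeries_zero]; norm_num)
  have hx := evalsTo_X t
  have h1 := evalsTo_one t
  have hn := fun n [Nat.AtLeastTwo n] => evalsTo_ofNat n t
  have hp := ((((hx.pow 4).neg.add ((hn 4).mul (hx.pow 3))).sub ((hn 5).mul (hx.pow 2))).add
    ((hn 2).mul hx))
  have hw := (hx.pow 2).mul (h1.sub hx)
  have hY' := (((((hn 2).mul hx).add ((((hn 4).mul (hx.pow 2)).mul ((h1.sub hx).pow 2)).mul
    (hr.pow 3))).add (hp.mul hr)).sub hw)
  rw [← hY] at hY'
  have hT' := (((((((hY'.sub ((hn 2).mul hx)).sub hp).add (hw.mul hq)).add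
    (hx.mul (h1.sub hx))).sub (hx.mul hq)).add ((((hn 4).mul (hx.pow 2)).mul (h1.sub hx)).mul hr)))
  rw [← hT] at hT'
  have quarter : ∀ {f : PowerSeries ℝ} {v : ℝ}, EvalsTo t (4 * f) v → EvalsTo t f (v / 4) := by
    intro f v h
    have := (evalsTo_C (1 / 4) t).mul h
    rw [← map_ofNat PowerSeries.C 4, ← mul_assoc, ← map_mul] at this
    simpa [div_eq_inv_mul] using this
  have sY := hasSum_HTerm (quarter hY')
  have sT := hasSum_HTerm (quarter hT')
  rw [altLen_singleton_of_ne Sign.noConfusion] at sY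
  rw [altLen_singleton_self] at sT
  have ht3 : t - 3 ≠ 0 := by
    have := (abs_lt.1 ht).2
    have := Real.sqrt_nonneg 2
    linarith
  -- The other two powers of `t² - 6t + 1` are expressed through its power `-1/2`.
  have hpow : (t ^ 2 - 6 * t + 1) ^ (1 / 2 : ℝ) =
      (t ^ 2 - 6 * t + 1) * (t ^ 2 - 6 * t + 1) ^ (-(1 / 2) : ℝ) := by
    rw [← Real.rpow_one_add' hD.le (by norm_num)]
    norm_num
  have hpow' : (t ^ 2 - 6 * t + 1) ^ (-(3 / 2) : ℝ) =
      ((t ^ 2 - 6 * t + 1) ^ (-(1 / 2) : ℝ)) ^ 3 := by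
    rw [← Real.rpow_mul_natCast hD.le]
    norm_num
  refine ⟨⟨sY.summable, ?_⟩, sT.summable, ?_⟩
  · rw [H, sY.tsum_eq, hpow, hpow']
    generalize (t ^ 2 - 6 * t + 1) ^ (-(1 / 2) : ℝ) = r
    field_simp
    ring
  · rw [H, H, sY.tsum_eq, sT.tsum_eq, hpow]
    generalize (t ^ 2 - 6 * t + 1) ^ (-(1 / 2) : ℝ) = r
    field_simp
    ring
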